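/- **Proposition 3.2.** Let $M$ be a smooth manifold (Hausdorff, second countable, without boundary, not necessarily compact) of dimension $m$, and let $q\ge m(m+1)/2$. A $q$-tuple $(\omega_1,\dots,\omega_q)$ of smooth 1-forms on $M$ is called *regular* if the linear map $$\Omega^1(M)^q\to\Omega^3(M),\qquad (\alpha_1,\dots,\alpha_q)\mapsto\sum_{i=1}^q\alpha_i\wedge d\omega_i,$$ on smooth forms is surjective. Then there exists a regular $q$-tuple $(\omega_1,\dots,\omega_q)$ of smooth 1-forms on $M$ such that $$\sum_{i=1}^q\omega_i\wedge d\omega_i=0.$$ Moreover, the tuple can be taken of the form $\omega_i=f_i^*\tau$ $(i=1,\dots,q)$, where $\tau$ is a smooth 1-form on $\mathbb R^2$ with $d\tau=dx\wedge dy$, and $f_1,\dots,f_q:M\to\mathbb R^2$ are smooth maps such that the 2-forms $f_1^*(dx\wedge dy),\dots,f_q^*(dx\wedge dy)$ span $\Lambda^2(T_x^*M)$ at every point $x\in M$. -/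

import Mathlib

open scoped Manifold ContDiff

noncomputable section

namespace ManifoldForms

/-- `ℝᵐ` with its Euclidean norm, the model space of `m`-manifolds. -/
abbrev Euc (m : ℕ) : Type := EuclideanSpace ℝ (Fin m)

/-- A (not necessarily smooth) differential `k`-form on an `m`-manifold `M`: an alternating
`k`-linear form on the tangent space at each point. -/
abbrev Form (m : ℕ) (M : Type*) [TopologicalSpace M] [ChartedSpace (Euc m) M] (k : ℕ) : Type _ :=
  ∀ x : M, (TangentSpace (𝓡 m) x) [⋀^Fin k]→L[ℝ] ℝ

/-- The exterior product `α ∧ β` of a `1`-form and a `k`-form on a vector space: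
`(α ∧ β)(v₀, …, v_k) = ∑ i, (-1)^i α(v_i) β(v₀, …, v_i omitted, …, v_k)`. -/
def wedgeLin {E : Type*} [NormedAddCommGroup E] [NormedSpace ℝ E] {k : ℕ}
    (α : E [⋀^Fin 1]→L[ℝ] ℝ) (β : E [⋀^Fin k]→L[ℝ] ℝ) : E [⋀^Fin (k + 1)]→L[ℝ] ℝ :=
  ContinuousAlternatingMap.alternatizeUncurryFin
    (((ContinuousAlternatingMap.ofSubsingleton ℝ E ℝ (0 : Fin 1)).symm α).smulRight β)

section

variable {m n : ℕ} {M N : Type*} [TopologicalSpace M] [ChartedSpace (Euc m) M]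
  [TopologicalSpace N] [ChartedSpace (Euc n) N] {k : ℕ}

/-- The exterior product `α ∧ β` of a `1`-form and a `k`-form on a manifold. -/
def wedge (α : Form m M 1) (β : Form m M k) : Form m M (k + 1) :=
  fun x => wedgeLin (E := Euc m) (α x) (β x)

/-- The pullback `f^* θ`. -/
def pullback (f : M → N) (θ : Form n N k) : Form m M k :=
  fun x => (θ (f x)).compContinuousLinearMap (mfderiv (𝓡 m) (𝓡 n) f x)

/-- The expression of `θ` in the chart `e`: the pullback of `θ` along `e⁻¹`, a form on `ℝᵐ`
(meaningful on the open set `e.target`). -/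
def inChart (θ : Form m M k) (e : OpenPartialHomeomorph M (Euc m)) :
    Euc m → (Euc m) [⋀^Fin k]→L[ℝ] ℝ :=
  pullback (m := m) (M := Euc m) (n := m) (N := M) e.symm θ

/-- A form is smooth if its expression in every chart of the atlas is smooth. -/
def IsSmooth (θ : Form m M k) : Prop :=
  ∀ e ∈ atlas (Euc m) M, ContDiffOn ℝ ∞ (inChart θ e) e.target

/-- The exterior derivative: at `x`, take the exterior derivative of the expression of `θ` in the
preferred chart at `x`, and pull it back to `T_x M` by the derivative of that chart. (On smooth
forms every other chart gives the same result.) -/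
def extD (θ : Form m M k) : Form m M (k + 1) :=
  fun x => (extDeriv (inChart θ (chartAt (Euc m) x)) (chartAt (Euc m) x x)).compContinuousLinearMap
    (mfderiv (𝓡 m) (𝓡 m) (chartAt (Euc m) x) x)

/-- A `q`-tuple `(θ_1, …, θ_q)` of smooth `1`-forms is regular if the linear map
`(α_1, …, α_q) ↦ ∑ i, α_i ∧ dθ_i`, from `q`-tuples of smooth `1`-forms to smooth `3`-forms,
is surjective. -/
def IsRegular {q : ℕ} (θ : Fin q → Form m M 1) : Prop :=
  (∀ i, IsSmooth (θ i)) ∧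
    ∀ η : Form m M 3, IsSmooth η →
      ∃ α : Fin q → Form m M 1, (∀ i, IsSmooth (α i)) ∧ ∑ i, wedge (α i) (extD (θ i)) = η

end

/-- The coordinate `1`-forms `dx` (`j = 0`) and `dy` (`j = 1`) on the plane `ℝ²`. -/
def dcoord (j : Fin 2) : Form 2 (Euc 2) 1 :=
  fun _ => ContinuousAlternatingMap.ofSubsingleton ℝ (Euc 2) ℝ (0 : Fin 1)
    (EuclideanSpace.proj j)

/-- The area form `dx ∧ dy` on `ℝ²`. -/
def areaForm : Form 2 (Euc 2) 2 := wedge (dcoord 0) (dcoord 1)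

end ManifoldForms

end

/-! Take τ = x dy and θ_i = f_i^*τ. Then dθ_i = f_i^*(dx ∧ dy), and θ_i ∧ dθ_i vanishes because it
is pulled back from a 3-form on the plane. What remains is that spanning implies regularity, and
that spanning maps exist.

Regularity: if the 2-forms df_i^0 ∧ df_i^1 span, then their products with the global 1-forms df_j^t
span the 3-forms (`span_wedgeLin_three_eq_top`). Inverting a Gram operator yields smooth
coefficients without a partition of unity (`exists_smooth_coefficients`).

Existence: the 2-forms fail to span at x exactly when some nonzero bivector ξ annihilates all of
them. Pairs (x, ξ), with one coordinate of ξ scaled to 1, have m + m(m-1)/2 - 1 = m(m+1)/2 - 1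
parameters, fewer than the q equations. Hence, in the space of possible derivatives, bad
translations have positive codimension. This is transversality, proved by counting Hausdorff
dimension (`dimH_annihilated_le`, `dense_nondegenerate`). The maps f_i are locally finite
combinations of cut-off chart coordinates; near each point, good coefficients form an open dense set
(`exists_open_dense_span`), and Baire's theorem over a countable cover finishes. -/

noncomputable section

namespace ManifoldForms
open Topology Filter ENNReal

/-! ### Exterior algebra of 1-forms and k-forms on a vector space. -/

section Algebra

variable {E E' : Type*} [NormedAddCommGroup E] [NormedSpace ℝ E]
  [NormedAddCommGroup E'] [NormedSpace ℝ E'] {k : ℕ}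

/-- A covector regarded as an alternating `1`-form. -/
def covector : (E →L[ℝ] ℝ) →L[ℝ] (E [⋀^Fin 1]→L[ℝ] ℝ) :=
  (ContinuousAlternatingMap.ofSubsingletonLIE (𝕜 := ℝ) (E := E) (F := ℝ)
    (0 : Fin 1)).toContinuousLinearEquiv

theorem covector_apply (u : E →L[ℝ] ℝ) (v : Fin 1 → E) : covector u v = u (v 0) := rfl

theorem covector_surjective : Function.Surjective (covector : (E →L[ℝ] ℝ) → _) :=
  (ContinuousAlternatingMap.ofSubsingletonLIE (𝕜 := ℝ) (E := E) (F := ℝ) (0 : Fin 1)).surjective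

/-- The exterior product of a `1`-form and a `k`-form as a continuous bilinear map. -/
def wedgeBilin : (E [⋀^Fin 1]→L[ℝ] ℝ) →L[ℝ] (E [⋀^Fin k]→L[ℝ] ℝ) →L[ℝ]
    (E [⋀^Fin (k + 1)]→L[ℝ] ℝ) :=
  (ContinuousLinearMap.compL ℝ _ _ _
      (ContinuousAlternatingMap.alternatizeUncurryFinCLM ℝ E ℝ (n := k))).comp
    ((ContinuousLinearMap.smulRightL ℝ E (E [⋀^Fin k]→L[ℝ] ℝ)).comp
      ((ContinuousAlternatingMap.ofSubsingletonLIE (𝕜 := ℝ) (E := E) (F := ℝ)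
        (0 : Fin 1)).symm.toContinuousLinearEquiv :
        (E [⋀^Fin 1]→L[ℝ] ℝ) →L[ℝ] (E →L[ℝ] ℝ)))

theorem wedgeBilin_apply (α : E [⋀^Fin 1]→L[ℝ] ℝ) (β : E [⋀^Fin k]→L[ℝ] ℝ) :
    wedgeBilin α β = wedgeLin α β := rfl

theorem wedgeLin_apply (α : E [⋀^Fin 1]→L[ℝ] ℝ) (β : E [⋀^Fin k]→L[ℝ] ℝ)
    (v : Fin (k + 1) → E) :
    wedgeLin α β v =
      ∑ i : Fin (k + 1), (-1) ^ (i : ℕ) • (α (fun _ => v i) * β (i.removeNth v)) := by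
  rw [wedgeLin, ContinuousAlternatingMap.alternatizeUncurryFin_apply]
  rfl

theorem wedgeLin_comp (α : E' [⋀^Fin 1]→L[ℝ] ℝ) (β : E' [⋀^Fin k]→L[ℝ] ℝ) (L : E →L[ℝ] E') :
    (wedgeLin α β).compContinuousLinearMap L =
      wedgeLin (α.compContinuousLinearMap L) (β.compContinuousLinearMap L) := by
  ext v
  simp only [ContinuousAlternatingMap.compContinuousLinearMap_apply, wedgeLin_apply]
  rfl

theorem wedgeLin_covector_apply_two (u v : E →L[ℝ] ℝ) (x : Fin 2 → E) :
    wedgeLin (covector u) (covector v) x = u (x 0) * v (x 1) - u (x 1) * v (x 0) := by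
  rw [wedgeLin_apply, Fin.sum_univ_two]
  simp [covector_apply, Fin.removeNth, Fin.tail]
  ring

theorem wedgeLin_covector_swap (u v : E →L[ℝ] ℝ) :
    wedgeLin (covector u) (covector v) = - wedgeLin (covector v) (covector u) := by
  ext x
  simp only [ContinuousAlternatingMap.neg_apply, wedgeLin_covector_apply_two]
  ring

variable {ι : Type*} [Fintype ι] (b : Module.Basis ι ℝ E) [FiniteDimensional ℝ E]

/-- Euler's formula `∑ c, eᶜ ∧ ι_{e_c} β = (k + 1) β`. -/
theorem sum_wedgeLin_curryLeft (β : E [⋀^Fin (k + 1)]→L[ℝ] ℝ) :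
    ∑ c, wedgeLin (covector (LinearMap.toContinuousLinearMap (b.coord c))) (β.curryLeft (b c)) =
      (k + 1) • β := by
  rw [← ContinuousAlternatingMap.alternatizeUncurryFin_curryLeft]
  have h : β.curryLeft = ∑ c, (LinearMap.toContinuousLinearMap (b.coord c)).smulRight
      (β.curryLeft (b c)) := by
    ext1 x
    conv_lhs => rw [← b.sum_repr x, map_sum]
    simp
  conv_rhs => rw [h, ← ContinuousAlternatingMap.alternatizeUncurryFinCLM_apply, map_sum]
  rfl

theorem covector_eq_sum (u : E →L[ℝ] ℝ) :
    u = ∑ c, u (b c) • LinearMap.toContinuousLinearMap (b.coord c) := by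
  ext x
  conv_lhs => rw [← b.sum_repr x, map_sum]
  simp [mul_comm]

/-- `k+1`-forms are spanned by products of `1`-forms with `k`-forms. -/
theorem mem_of_forall_wedgeLin_mem (p : Submodule ℝ (E [⋀^Fin (k + 1)]→L[ℝ] ℝ))
    (h : ∀ (u : E →L[ℝ] ℝ) (β : E [⋀^Fin k]→L[ℝ] ℝ), wedgeLin (covector u) β ∈ p) : p = ⊤ := by
  refine eq_top_iff.2 fun β _ => ?_
  have h1 := sum_wedgeLin_curryLeft (Module.finBasis ℝ E) β
  -- Euler's formula puts (k + 1)β in p, and k + 1 is invertible in ℝ.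
  have h2 : (k + 1) • β ∈ p := h1 ▸ p.sum_mem fun c _ => h _ _
  have h3 : ((k : ℝ) + 1) • β ∈ p := by
    have : ((k : ℝ) + 1) • β = (k + 1) • β := by
      rw [← Nat.cast_succ, Nat.cast_smul_eq_nsmul]
    rwa [this]
  exact (p.smul_mem_iff (by positivity)).1 h3

instance finiteDimensional_alternating : FiniteDimensional ℝ (E [⋀^Fin k]→L[ℝ] ℝ) := by
  let b := Module.finBasis ℝ E
  let φ : (E [⋀^Fin k]→L[ℝ] ℝ) →ₗ[ℝ] ((Fin k → Fin (Module.finrank ℝ E)) → ℝ) :=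
    { toFun := fun β s => β fun i => b (s i)
      map_add' := fun _ _ => rfl
      map_smul' := fun _ _ => rfl }
  refine Module.Finite.of_injective φ fun β γ h => ?_
  apply ContinuousAlternatingMap.toContinuousMultilinearMap_injective
  apply ContinuousMultilinearMap.toMultilinearMap_injective
  exact Module.Basis.ext_multilinear (fun _ => b) fun s => congrFun h s

/-- The products `eᶜ ∧ eᵈ` of covectors span the `2`-forms. -/
theorem linearMap_eq_zero_of_forall_coord (l : (E [⋀^Fin 2]→L[ℝ] ℝ) →ₗ[ℝ] ℝ)
    (h : ∀ c d, l (wedgeLin (covector (LinearMap.toContinuousLinearMap (b.coord c)))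
      (covector (LinearMap.toContinuousLinearMap (b.coord d)))) = 0) : l = 0 := by
  have : LinearMap.ker l = ⊤ := mem_of_forall_wedgeLin_mem _ fun u β => by
    obtain ⟨v, rfl⟩ := covector_surjective β
    rw [LinearMap.mem_ker, covector_eq_sum b u, covector_eq_sum b v, ← wedgeBilin_apply]
    simp only [map_sum, sum_apply, map_smul, smul_apply,
      wedgeBilin_apply, h]
    simp
  exact LinearMap.ker_eq_top.1 this

end Algebra

/-! ### Spanning of 2-forms, dualized to bivectors. -/

section Nondegenerate

variable {m q : ℕ}

/-- The value of the bivector `ξ` on the `i`-th pair of covectors of the family `w`. -/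
def pairing (ξ : Fin m → Fin m → ℝ) (w : Fin q × Fin 2 × Fin m → ℝ) (i : Fin q) : ℝ :=
  ∑ c, ∑ d, ξ c d * (w (i, 0, c) * w (i, 1, d))

/-- No nonzero bivector is annihilated by all the pairs of covectors of the family `w`. -/
def Nondegenerate (w : Fin q × Fin 2 × Fin m → ℝ) : Prop :=
  ∀ ξ : Fin m → Fin m → ℝ, (∀ c d, ξ c d = - ξ d c) → ξ ≠ 0 → ∃ i, pairing ξ w i ≠ 0

/-- A proper span lies in the kernel of some functional l ≠ 0. The numbers l(eᶜ ∧ eᵈ) form a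
bivector, nonzero since the eᶜ ∧ eᵈ span, whose i-th pairing is l(u_i ∧ v_i) = 0. -/
theorem Nondegenerate.span_eq_top {E : Type*} [NormedAddCommGroup E] [NormedSpace ℝ E]
    [FiniteDimensional ℝ E] (b : Module.Basis (Fin m) ℝ E) {u v : Fin q → E →L[ℝ] ℝ}
    (h : Nondegenerate fun s : Fin q × Fin 2 × Fin m => (![u s.1, v s.1] s.2.1) (b s.2.2)) :
    Submodule.span ℝ (Set.range fun i => wedgeLin (covector (u i)) (covector (v i))) = ⊤ := by
  by_contra hne
  obtain ⟨l, hl0, hl⟩ := Submodule.exists_le_ker_of_lt_top _ (lt_top_iff_ne_top.2 hne)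
  let e : Fin m → E →L[ℝ] ℝ := fun c => LinearMap.toContinuousLinearMap (b.coord c)
  obtain ⟨i, hi⟩ := h (fun c d => l (wedgeLin (covector (e c)) (covector (e d))))
    (fun c d => by rw [wedgeLin_covector_swap, map_neg]) (fun h0 => hl0
      (linearMap_eq_zero_of_forall_coord b l fun c d => congrFun (congrFun h0 c) d))
  apply hi
  have h1 : l (wedgeLin (covector (u i)) (covector (v i))) = 0 :=
    hl (Submodule.subset_span ⟨i, rfl⟩)
  rw [covector_eq_sum b (u i), covector_eq_sum b (v i), ← wedgeBilin_apply] at h1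
  simp only [map_sum, sum_apply, map_smul, smul_apply,
    wedgeBilin_apply] at h1
  rw [← h1, pairing, Finset.sum_comm]
  refine Finset.sum_congr rfl fun d _ => ?_
  simp [e, mul_comm, mul_left_comm, mul_assoc, Finset.mul_sum]

end Nondegenerate

/-! ### From spanning 2-forms to spanning 3-forms. -/

section ThreeForms

variable {E : Type*} [NormedAddCommGroup E] [NormedSpace ℝ E] [FiniteDimensional ℝ E]

/-- If the `2`-forms `u i ∧ v i` span, then so do the `3`-forms `g ∧ u i ∧ v i`, where `g` ranges
over the covectors `u j` and `v j`. -/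
theorem span_wedgeLin_three_eq_top {ι : Type*} [Finite ι] (g : ι → Fin 2 → E →L[ℝ] ℝ)
    (h : Submodule.span ℝ (Set.range fun i => wedgeLin (covector (g i 0)) (covector (g i 1))) = ⊤) :
    Submodule.span ℝ (Set.range fun s : ι × ι × Fin 2 =>
      wedgeLin (covector (g s.2.1 s.2.2))
        (wedgeLin (covector (g s.1 0)) (covector (g s.1 1)))) = ⊤ := by
  set p := Submodule.span ℝ (Set.range fun s : ι × ι × Fin 2 =>
      wedgeLin (covector (g s.2.1 s.2.2))
        (wedgeLin (covector (g s.1 0)) (covector (g s.1 1)))) with hp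
  have key : ∀ s : ι × Fin 2, ∀ β : E [⋀^Fin 2]→L[ℝ] ℝ,
      wedgeLin (covector (g s.1 s.2)) β ∈ p := by
    intro s β
    have hβ : β ∈ Submodule.span ℝ
        (Set.range fun i => wedgeLin (covector (g i 0)) (covector (g i 1))) := h ▸ trivial
    induction hβ using Submodule.span_induction with
    | mem x hx =>
      obtain ⟨i, rfl⟩ := hx
      exact Submodule.subset_span ⟨(i, s), rfl⟩
    | zero => rw [← wedgeBilin_apply, map_zero]; exact p.zero_mem
    | add x y _ _ hx hy => rw [← wedgeBilin_apply, map_add]; exact p.add_mem hx hy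
    | smul a x _ hx => rw [← wedgeBilin_apply, map_smul]; exact p.smul_mem _ hx
  by_cases hg : Submodule.span ℝ (Set.range fun s : ι × Fin 2 => g s.1 s.2) = ⊤
  · refine mem_of_forall_wedgeLin_mem p fun u β => ?_
    have hu : u ∈ Submodule.span ℝ (Set.range fun s : ι × Fin 2 => g s.1 s.2) := hg ▸ trivial
    induction hu using Submodule.span_induction with
    | mem x hx => obtain ⟨s, rfl⟩ := hx; exact key s β
    | zero => rw [← wedgeBilin_apply, map_zero, map_zero]; exact p.zero_mem
    | add x y _ _ hx hy =>
      rw [← wedgeBilin_apply, map_add, map_add, add_apply]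
      exact p.add_mem hx hy
    | smul a x _ hx =>
      rw [← wedgeBilin_apply, map_smul, map_smul, smul_apply]
      exact p.smul_mem _ hx
  -- Otherwise a nonzero vector x is killed by every `g i t`. By the spanning hypothesis every
  -- 2-form then vanishes on (x, ·), which forces the space to be a line, where there are no nonzero
  -- 2-forms.
  · obtain ⟨l, hl0, hl⟩ := Submodule.exists_le_ker_of_lt_top _ (lt_top_iff_ne_top.2 hg)
    obtain ⟨x, hx⟩ : ∃ x : E, ∀ u : E →L[ℝ] ℝ, l u = u x := by
      obtain ⟨x, hx⟩ := (Module.evalEquiv ℝ E).surjective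
        (l ∘ₗ (LinearMap.toContinuousLinearMap : (E →ₗ[ℝ] ℝ) ≃ₗ[ℝ] (E →L[ℝ] ℝ)).toLinearMap)
      refine ⟨x, fun u => ?_⟩
      have := LinearMap.congr_fun hx (u : E →ₗ[ℝ] ℝ)
      exact this.symm
    have hgx : ∀ i t, g i t x = 0 := fun i t => by
      rw [← hx]; exact hl (Submodule.subset_span ⟨(i, t), rfl⟩)
    have h2 : ∀ β : E [⋀^Fin 2]→L[ℝ] ℝ, ∀ y, β ![x, y] = 0 := by
      intro β y
      have hβ : β ∈ Submodule.span ℝ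
        (Set.range fun i => wedgeLin (covector (g i 0)) (covector (g i 1))) := h ▸ trivial
      induction hβ using Submodule.span_induction with
      | mem z hz => obtain ⟨i, rfl⟩ := hz; simp [wedgeLin_covector_apply_two, hgx]
      | zero => rfl
      | add z w _ _ hz hw => simp [hz, hw]
      | smul a z _ hz => simp [hz]
    obtain ⟨φ, hφ⟩ : ∃ φ : E →L[ℝ] ℝ, φ x ≠ 0 := by
      by_contra! hc
      exact hl0 (LinearMap.ext fun u => by rw [hx, hc]; rfl)
    have h3 : ∀ y, ∃ a : ℝ, y = a • x := by
      intro y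
      refine ⟨φ y / φ x, ?_⟩
      by_contra hne
      obtain ⟨ψ, hψ⟩ : ∃ ψ : E →L[ℝ] ℝ, ψ (y - (φ y / φ x) • x) ≠ 0 := by
        obtain ⟨ψ, -, hψ⟩ := exists_dual_vector ℝ _ (norm_ne_zero_iff.2 (sub_ne_zero.2 hne))
        exact ⟨ψ, by rw [hψ]; simpa using sub_ne_zero.2 hne⟩
      -- The value of φ ∧ ψ at (x, y) being zero says φ(x)ψ(y) = φ(y)ψ(x), so ψ cannot detect y - (φ
      -- y / φ x) x.
      have := h2 (wedgeLin (covector φ) (covector ψ)) y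
      rw [wedgeLin_covector_apply_two] at this
      simp only [Matrix.cons_val_zero, Matrix.cons_val_one] at this
      apply hψ
      rw [map_sub, map_smul, smul_eq_mul]
      field_simp
      linarith
    have h4 : ∀ β : E [⋀^Fin 2]→L[ℝ] ℝ, β = 0 := by
      intro β
      ext z
      obtain ⟨a, ha⟩ := h3 (z 0)
      obtain ⟨c, hc⟩ := h3 (z 1)
      have hz : z = ![a • x, c • x] := by
        ext i; fin_cases i
        · exact ha
        · exact hc
      rw [hz]
      have h5 := β.map_update_smul ![x, c • x] 0 a x
      have e1 : Function.update ![x, c • x] 0 (a • x) = ![a • x, c • x] := by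
        ext i; fin_cases i <;> rfl
      have e2 : Function.update ![x, c • x] 0 x = ![x, c • x] := by
        ext i; fin_cases i <;> rfl
      rw [e1, e2, h2, smul_zero] at h5
      exact h5
    refine mem_of_forall_wedgeLin_mem p fun u β => ?_
    rw [h4 β, ← wedgeBilin_apply, map_zero]
    exact p.zero_mem

end ThreeForms

/-! ### Canonical coefficients with respect to a spanning family. -/

section Gram

variable {V : Type*} [NormedAddCommGroup V] [NormedSpace ℝ V] {κ : Type*} [Fintype κ]

/-- The map `l ↦ ∑ i, l (s i) • s i` from the dual of `V` to `V`. -/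
def gram (s : κ → V) : (V →L[ℝ] ℝ) →L[ℝ] V :=
  ∑ i, (ContinuousLinearMap.apply ℝ ℝ (s i)).smulRight (s i)

theorem gram_apply (s : κ → V) (l : V →L[ℝ] ℝ) : gram s l = ∑ i, l (s i) • s i := by
  simp [gram]

/-- Applying l to `gram s l = 0` gives ∑ l(s i)² = 0, so l vanishes on a spanning family. -/
theorem gram_injective {s : κ → V} (hs : Submodule.span ℝ (Set.range s) = ⊤) :
    Function.Injective (gram s) := by
  rw [injective_iff_map_eq_zero]
  intro l hl
  have h1 : ∑ i, l (s i) * l (s i) = 0 := by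
    have := congrArg l hl
    rw [gram_apply, map_sum, map_zero] at this
    simpa using this
  have h2 : ∀ i, l (s i) = 0 := fun i => by
    simpa using (Finset.sum_eq_zero_iff_of_nonneg fun i _ => mul_self_nonneg (l (s i))).1 h1 i
      (Finset.mem_univ i)
  have h3 : (⊤ : Submodule ℝ V) ≤ LinearMap.ker (l : V →ₗ[ℝ] ℝ) := by
    rw [← hs, Submodule.span_le]
    rintro _ ⟨i, rfl⟩
    exact h2 i
  ext x
  exact h3 (Submodule.mem_top (x := x))

variable [FiniteDimensional ℝ V]

theorem exists_equiv_eq_gram {s : κ → V} (hs : Submodule.span ℝ (Set.range s) = ⊤) :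
    ∃ G : (V →L[ℝ] ℝ) ≃L[ℝ] V, (G : (V →L[ℝ] ℝ) →L[ℝ] V) = gram s := by
  have hd : Module.finrank ℝ (V →L[ℝ] ℝ) = Module.finrank ℝ V := by
    rw [← (LinearMap.toContinuousLinearMap : (V →ₗ[ℝ] ℝ) ≃ₗ[ℝ] (V →L[ℝ] ℝ)).finrank_eq]
    exact Subspace.dual_finrank_eq
  refine ⟨(LinearEquiv.ofInjectiveOfFinrankEq (gram s : (V →L[ℝ] ℝ) →ₗ[ℝ] V)
    (gram_injective hs) hd).toContinuousLinearEquiv, ?_⟩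
  ext l
  rfl

/-- Requiring the coefficients to come from a functional makes them unique, hence independent of the
chart in which they are computed. -/
theorem exists_gram_coefficients {s : κ → V} (hs : Submodule.span ℝ (Set.range s) = ⊤) (η : V) :
    ∃ a : κ → ℝ, (∃ l : V →L[ℝ] ℝ, ∀ i, a i = l (s i)) ∧ ∑ i, a i • s i = η := by
  obtain ⟨G, hG⟩ := exists_equiv_eq_gram hs
  refine ⟨fun i => G.symm η (s i), ⟨G.symm η, fun i => rfl⟩, ?_⟩
  rw [← gram_apply, ← hG]
  exact G.apply_symm_apply η

/-- The functional must be the inverse Gram operator applied to η, and inversion is smooth at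
invertible operators. -/
theorem contDiffAt_gram_coefficients {Y : Type*} [NormedAddCommGroup Y] [NormedSpace ℝ Y]
    {n : WithTop ℕ∞} {s : κ → Y → V} {η : Y → V} {a : κ → Y → ℝ} {y₀ : Y}
    (hs : ∀ i, ContDiffAt ℝ n (s i) y₀) (hη : ContDiffAt ℝ n η y₀)
    (hspan : ∀ᶠ y in 𝓝 y₀, Submodule.span ℝ (Set.range fun i => s i y) = ⊤)
    (ha : ∀ᶠ y in 𝓝 y₀, (∃ l : V →L[ℝ] ℝ, ∀ i, a i y = l (s i y)) ∧ ∑ i, a i y • s i y = η y)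
    (i : κ) : ContDiffAt ℝ n (a i) y₀ := by
  have hgram : ContDiffAt ℝ n (fun y => gram fun i => s i y) y₀ := by
    have h (v : Y → V) (hv : ContDiffAt ℝ n v y₀) :
        ContDiffAt ℝ n (fun y => ContinuousLinearMap.apply ℝ ℝ (v y)) y₀ :=
      contDiffAt_const.clm_apply hv
    exact ContDiffAt.sum fun i _ => (h _ (hs i)).smulRight (hs i)
  obtain ⟨G, hG⟩ := exists_equiv_eq_gram hspan.self_of_nhds
  have hinv : ContDiffAt ℝ n (fun y => ContinuousLinearMap.inverse (gram fun i => s i y)) y₀ := by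
    refine ContDiffAt.comp (g := ContinuousLinearMap.inverse) y₀ ?_ hgram
    rw [← hG]
    exact contDiffAt_map_inverse G
  refine ((hinv.clm_apply hη).clm_apply (hs i)).congr_of_eventuallyEq ?_
  filter_upwards [hspan, ha] with y h1 h2
  obtain ⟨⟨l, hl⟩, h3⟩ := h2
  obtain ⟨G', hG'⟩ := exists_equiv_eq_gram h1
  rw [← hG', ContinuousLinearMap.inverse_equiv, hl i]
  congr 1
  symm
  rw [ContinuousLinearEquiv.coe_coe, ContinuousLinearEquiv.symm_apply_eq, ← h3,
    ← ContinuousLinearEquiv.coe_coe, hG', gram_apply]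
  simp only [hl]

end Gram

/-! ### Smooth forms on manifolds and their chart expressions. -/

section Forms

variable {m : ℕ} {M : Type*} [TopologicalSpace M] [ChartedSpace (Euc m) M] {k : ℕ}

/-- The derivative of the inverse of a chart, as a map between model spaces. -/
def symmDeriv (e : OpenPartialHomeomorph M (Euc m)) (y : Euc m) : Euc m →L[ℝ] Euc m :=
  mfderiv (𝓡 m) (𝓡 m) e.symm y

/-- The derivative of a chart, as a map between model spaces. -/
def chartDeriv (e : OpenPartialHomeomorph M (Euc m)) (x : M) : Euc m →L[ℝ] Euc m :=
  mfderiv (𝓡 m) (𝓡 m) e x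

/-- The value of a form at a point, as a form on the model space. -/
def Form.at (θ : Form m M k) (x : M) : (Euc m) [⋀^Fin k]→L[ℝ] ℝ := θ x

theorem inChart_apply (θ : Form m M k) (e : OpenPartialHomeomorph M (Euc m)) (y : Euc m) :
    inChart θ e y = (θ.at (e.symm y)).compContinuousLinearMap (symmDeriv e y) := rfl

theorem inChart_wedge (α : Form m M 1) (β : Form m M k) (e : OpenPartialHomeomorph M (Euc m))
    (y : Euc m) : inChart (wedge α β) e y = wedgeLin (inChart α e y) (inChart β e y) :=
  wedgeLin_comp (α.at (e.symm y)) (β.at (e.symm y)) (symmDeriv e y)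

theorem contDiffOn_wedgeLin {E Y : Type*} [NormedAddCommGroup E] [NormedSpace ℝ E]
    [NormedAddCommGroup Y] [NormedSpace ℝ Y] {r : WithTop ℕ∞} {α : Y → E [⋀^Fin 1]→L[ℝ] ℝ}
    {β : Y → E [⋀^Fin k]→L[ℝ] ℝ} {U : Set Y}
    (hα : ContDiffOn ℝ r α U) (hβ : ContDiffOn ℝ r β U) :
    ContDiffOn ℝ r (fun y => wedgeLin (α y) (β y)) U := by
  have h : ContDiff ℝ r (wedgeBilin (E := E) (k := k)) :=
    ContinuousLinearMap.contDiff (E := E [⋀^Fin 1]→L[ℝ] ℝ)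
      (F := (E [⋀^Fin k]→L[ℝ] ℝ) →L[ℝ] (E [⋀^Fin (k + 1)]→L[ℝ] ℝ)) _
  exact (h.comp_contDiffOn hα).clm_apply hβ

theorem IsSmooth.wedge {α : Form m M 1} {β : Form m M k} (hα : IsSmooth α) (hβ : IsSmooth β) :
    IsSmooth (wedge α β) := fun e he =>
  (contDiffOn_wedgeLin (hα e he) (hβ e he)).congr fun y _ => inChart_wedge α β e y

theorem inChart_sum_smul {κ : Type*} [Fintype κ] (a : κ → M → ℝ) (θ : κ → Form m M k)
    (e : OpenPartialHomeomorph M (Euc m)) (y : Euc m) :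
    inChart (fun x => ∑ i, a i x • θ i x : Form m M k) e y =
      ∑ i, a i (e.symm y) • inChart (θ i) e y := by
  have h := map_sum (ContinuousAlternatingMap.compContinuousLinearMapCLM (F := ℝ) (ι := Fin k)
    (symmDeriv e y)) (fun i => a i (e.symm y) • (θ i).at (e.symm y)) Finset.univ
  simp only [map_smul] at h
  exact h

theorem IsSmooth.sum_smul {κ : Type*} [Fintype κ] {a : κ → M → ℝ} {θ : κ → Form m M k}
    (ha : ∀ i, ∀ e ∈ atlas (Euc m) M, ContDiffOn ℝ ∞ (fun y => a i (e.symm y)) e.target)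
    (hθ : ∀ i, IsSmooth (θ i)) : IsSmooth (fun x => ∑ i, a i x • θ i x : Form m M k) := by
  intro e he
  have : ContDiffOn ℝ ∞ (fun y => ∑ i, a i (e.symm y) • inChart (θ i) e y) e.target :=
    ContDiffOn.sum fun i _ => (ha i e he).smul (hθ i e he)
  exact this.congr fun y _ => inChart_sum_smul a θ e y

variable [IsManifold (𝓡 m) ∞ M]

theorem chart_mdifferentiable {e : OpenPartialHomeomorph M (Euc m)}
    (he : e ∈ atlas (Euc m) M) : e.MDifferentiable (𝓡 m) (𝓡 m) :=
  haveI : IsManifold (𝓡 m) 1 M := IsManifold.of_le (n := ∞) (by exact_mod_cast le_top)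
  mdifferentiable_of_mem_atlas he

theorem symmDeriv_comp_chartDeriv {e : OpenPartialHomeomorph M (Euc m)}
    (he : e ∈ atlas (Euc m) M) {x : M} (hx : x ∈ e.source) :
    (symmDeriv e (e x)).comp (chartDeriv e x) = ContinuousLinearMap.id ℝ (Euc m) :=
  (chart_mdifferentiable he).symm_comp_deriv hx

theorem chartDeriv_comp_symmDeriv {e : OpenPartialHomeomorph M (Euc m)}
    (he : e ∈ atlas (Euc m) M) {y : Euc m} (hy : y ∈ e.target) :
    (chartDeriv e (e.symm y)).comp (symmDeriv e y) = ContinuousLinearMap.id ℝ (Euc m) :=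
  (chart_mdifferentiable he).comp_symm_deriv hy

/-- Forms that span at a point also span after an invertible change of variables. -/
theorem span_range_compContinuousLinearMap {κ : Type*} {E : Type*} [NormedAddCommGroup E]
    [NormedSpace ℝ E] {s : κ → E [⋀^Fin k]→L[ℝ] ℝ}
    (hs : Submodule.span ℝ (Set.range s) = ⊤) {L L' : E →L[ℝ] E}
    (h : L'.comp L = ContinuousLinearMap.id ℝ E) :
    Submodule.span ℝ (Set.range fun i => (s i).compContinuousLinearMap L) = ⊤ := by
  have h1 := congrArg (Submodule.map (ContinuousAlternatingMap.compContinuousLinearMapCLM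
    (F := ℝ) (ι := Fin k) L).toLinearMap) hs
  rw [Submodule.map_span, ← Set.range_comp, Submodule.map_top, LinearMap.range_eq_top.2] at h1
  · exact h1
  · intro β
    refine ⟨β.compContinuousLinearMap L', ?_⟩
    ext v
    have h2 : ∀ x, L' (L x) = x := fun x => DFunLike.congr_fun h x
    simp [Function.comp_def, h2]

/-- The differential of a function, as a `1`-form. -/
def differential (g : M → ℝ) : Form m M 1 :=
  fun x => covector (E := Euc m) (mfderiv (𝓡 m) 𝓘(ℝ, ℝ) g x)

theorem contDiffOn_comp_symm {F : Type*} [NormedAddCommGroup F] [NormedSpace ℝ F] {g : M → F}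
    (hg : ContMDiff (𝓡 m) 𝓘(ℝ, F) ∞ g) {e : OpenPartialHomeomorph M (Euc m)}
    (he : e ∈ atlas (Euc m) M) : ContDiffOn ℝ ∞ (fun y => g (e.symm y)) e.target :=
  contMDiffOn_iff_contDiffOn.1
    (hg.comp_contMDiffOn (contMDiffOn_symm_of_mem_maximalAtlas
      (IsManifold.subset_maximalAtlas he)))

theorem fderiv_comp_symm {F : Type*} [NormedAddCommGroup F] [NormedSpace ℝ F] {g : M → F}
    (hg : ContMDiff (𝓡 m) 𝓘(ℝ, F) ∞ g) {e : OpenPartialHomeomorph M (Euc m)}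
    (he : e ∈ atlas (Euc m) M) {y : Euc m} (hy : y ∈ e.target) :
    fderiv ℝ (fun y => g (e.symm y)) y =
      (mfderiv (𝓡 m) 𝓘(ℝ, F) g (e.symm y)).comp (mfderiv (𝓡 m) (𝓡 m) e.symm y) := by
  rw [← mfderiv_eq_fderiv]
  exact mfderiv_comp y ((hg.mdifferentiable (by simp)) _)
    ((chart_mdifferentiable he).mdifferentiableAt_symm hy)

theorem mfderiv_eq_fderiv_comp_symm {F : Type*} [NormedAddCommGroup F] [NormedSpace ℝ F]
    {g : M → F} (hg : ContMDiff (𝓡 m) 𝓘(ℝ, F) ∞ g) {e : OpenPartialHomeomorph M (Euc m)}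
    (he : e ∈ atlas (Euc m) M) {x : M} (hx : x ∈ e.source) :
    mfderiv (𝓡 m) 𝓘(ℝ, F) g x =
      (fderiv ℝ (fun y => g (e.symm y)) (e x)).comp (mfderiv (𝓡 m) (𝓡 m) e x) := by
  rw [← mfderiv_eq_fderiv]
  have h1 : MDifferentiableAt (𝓡 m) 𝓘(ℝ, F) (fun y => g (e.symm y)) (e x) :=
    (((contDiffOn_comp_symm hg he).contDiffAt (e.open_target.mem_nhds
      (e.map_source hx))).differentiableAt (by simp)).mdifferentiableAt
  have h2 : g =ᶠ[𝓝 x] (fun y => g (e.symm y)) ∘ e := by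
    filter_upwards [e.open_source.mem_nhds hx] with z hz
    simp [e.left_inv hz]
  rw [h2.mfderiv_eq]
  exact mfderiv_comp x h1 ((chart_mdifferentiable he).mdifferentiableAt hx)

theorem inChart_differential {g : M → ℝ} (hg : ContMDiff (𝓡 m) 𝓘(ℝ, ℝ) ∞ g)
    {e : OpenPartialHomeomorph M (Euc m)} (he : e ∈ atlas (Euc m) M) {y : Euc m}
    (hy : y ∈ e.target) :
    inChart (differential g) e y = covector (fderiv ℝ (fun y => g (e.symm y)) y) := by
  rw [fderiv_comp_symm hg he hy]
  rfl

theorem isSmooth_differential {g : M → ℝ} (hg : ContMDiff (𝓡 m) 𝓘(ℝ, ℝ) ∞ g) :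
    IsSmooth (differential g : Form m M 1) := by
  intro e he
  have h1 : ContDiffOn ℝ ∞ (fun y => fderiv ℝ (fun y => g (e.symm y)) y) e.target :=
    (contDiffOn_comp_symm hg he).fderiv_of_isOpen e.open_target (by simp)
  exact ((covector (E := Euc m)).contDiff.comp_contDiffOn h1).congr fun y hy =>
    inChart_differential hg he hy

/-- A smooth form is a combination with smooth coefficients of any smooth forms that span at every
point. -/
theorem exists_smooth_coefficients {κ : Type*} [Fintype κ] {s : κ → Form m M k} {η : Form m M k}
    (hs : ∀ i, IsSmooth (s i)) (hη : IsSmooth η)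
    (hspan : ∀ x, Submodule.span ℝ (Set.range fun i => s i x) = ⊤) :
    ∃ a : κ → M → ℝ,
      (∀ i, ∀ e ∈ atlas (Euc m) M, ContDiffOn ℝ ∞ (fun y => a i (e.symm y)) e.target) ∧
      ∀ x, ∑ i, a i x • s i x = η x := by
  have h : ∀ x, ∃ a : κ → ℝ, (∃ l : ((Euc m) [⋀^Fin k]→L[ℝ] ℝ) →L[ℝ] ℝ, ∀ i, a i = l (s i x)) ∧
      ∑ i, a i • (s i x : (Euc m) [⋀^Fin k]→L[ℝ] ℝ) = η x :=
    fun x => exists_gram_coefficients (V := (Euc m) [⋀^Fin k]→L[ℝ] ℝ) (hspan x) (η x)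
  choose a ha1 ha2 using h
  refine ⟨fun i x => a x i, fun i e he y hy => ?_, ha2⟩
  have hnhds : ∀ᶠ y' in 𝓝 y, y' ∈ e.target := e.open_target.mem_nhds hy
  refine (contDiffAt_gram_coefficients (s := fun i => inChart (s i) e) (η := inChart η e)
    (a := fun i y => a (e.symm y) i)
    (fun i => (hs i e he).contDiffAt hnhds) ((hη e he).contDiffAt hnhds) ?_ ?_ i).contDiffWithinAt
  · filter_upwards [hnhds] with z hz
    exact span_range_compContinuousLinearMap (s := fun i => (s i).at (e.symm z))
      (hspan (e.symm z)) (chartDeriv_comp_symmDeriv he hz)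
  · filter_upwards [hnhds] with z hz
    obtain ⟨l, hl⟩ := ha1 (e.symm z)
    -- The chart derivative transports the functional, so the canonical coefficients at the point
    -- are also canonical in the chart.
    refine ⟨⟨l.comp (ContinuousAlternatingMap.compContinuousLinearMapCLM
      (chartDeriv e (e.symm z))), fun i => ?_⟩, ?_⟩
    · have h3 : ∀ v, symmDeriv e z (chartDeriv e (e.symm z) v) = v := fun v => by
        have := DFunLike.congr_fun (symmDeriv_comp_chartDeriv he (e.map_target hz)) v
        rwa [e.right_inv hz] at this
      rw [hl i]
      refine congrArg l ?_
      change (s i).at (e.symm z) = _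
      ext v
      simp [inChart_apply, Function.comp_def, h3]
    · rw [← inChart_sum_smul (fun i x => a x i)]
      exact congrArg (fun θ : Form m M k => inChart θ e z) (funext fun x => ha2 x)

end Forms

/-! ### The primitive x dy on the plane. -/

section Plane

/-- The primitive `x dy` of the area form. -/
def xdy : Form 2 (Euc 2) 1 := fun p => p 0 • dcoord 1 p

theorem extDeriv_xdy (p : Euc 2) :
    extDeriv (fun p : Euc 2 => xdy.at p) p = areaForm.at p := by
  have h : HasFDerivAt (fun p : Euc 2 => xdy.at p)
      ((EuclideanSpace.proj (0 : Fin 2) : Euc 2 →L[ℝ] ℝ).smulRight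
        (covector (E := Euc 2) (EuclideanSpace.proj (1 : Fin 2)))) p :=
    HasFDerivAt.smul_const (F := (Euc 2) [⋀^Fin 1]→L[ℝ] ℝ)
      (EuclideanSpace.proj (0 : Fin 2) : Euc 2 →L[ℝ] ℝ).hasFDerivAt
      (covector (E := Euc 2) (EuclideanSpace.proj (1 : Fin 2)))
  rw [extDeriv, h.fderiv]
  rfl

theorem differentiable_xdy : Differentiable ℝ (fun p : Euc 2 => xdy.at p) := fun _ =>
  (EuclideanSpace.proj (0 : Fin 2) : Euc 2 →L[ℝ] ℝ).differentiableAt.smul_const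
    (covector (E := Euc 2) (EuclideanSpace.proj (1 : Fin 2)))

/-- Three vectors of the plane are linearly dependent. This is the source of θ_i ∧ dθ_i = 0. -/
theorem wedgeLin_xdy_area (p : Euc 2) : wedgeLin (xdy.at p) (areaForm.at p) = 0 := by
  ext v
  refine (wedgeLin (xdy.at p) (areaForm.at p)).toAlternatingMap.map_linearDependent v ?_
  intro h
  have := h.fintype_card_le_finrank
  simp at this

end Plane

/-! ### Pullbacks of x dy, and regularity from spanning. -/

section Pullback

variable {m : ℕ} {M : Type*} [TopologicalSpace M] [ChartedSpace (Euc m) M]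
  {f : M → Euc 2}

theorem contMDiff_coord (hf : ContMDiff (𝓡 m) (𝓡 2) ∞ f) (t : Fin 2) :
    ContMDiff (𝓡 m) 𝓘(ℝ, ℝ) ∞ fun x => f x t :=
  (EuclideanSpace.proj t : Euc 2 →L[ℝ] ℝ).contMDiff.comp hf

theorem mfderiv_coord (hf : ContMDiff (𝓡 m) (𝓡 2) ∞ f) (t : Fin 2) (x : M) :
    mfderiv (𝓡 m) 𝓘(ℝ, ℝ) (fun x => f x t) x =
      (EuclideanSpace.proj t : Euc 2 →L[ℝ] ℝ).comp (mfderiv (𝓡 m) (𝓡 2) f x) := by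
  have h := mfderiv_comp x ((EuclideanSpace.proj t : Euc 2 →L[ℝ] ℝ).mdifferentiableAt (x := f x))
    (hf.mdifferentiable (by simp) x)
  rw [ContinuousLinearMap.mfderiv_eq] at h
  exact h

theorem wedge_pullback_xdy :
    wedge (pullback f xdy : Form m M 1) (pullback f areaForm) = 0 := by
  funext x
  refine (wedgeLin_comp (E := Euc m) (xdy.at (f x)) (areaForm.at (f x))
    (mfderiv (𝓡 m) (𝓡 2) f x)).symm.trans ?_
  rw [wedgeLin_xdy_area]
  rfl

theorem pullback_dcoord (hf : ContMDiff (𝓡 m) (𝓡 2) ∞ f) (t : Fin 2) (x : M) :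
    (pullback f (dcoord t) : Form m M 1) x = differential (fun x => f x t) x := by
  rw [differential, mfderiv_coord hf]
  rfl

theorem pullback_xdy (hf : ContMDiff (𝓡 m) (𝓡 2) ∞ f) :
    (pullback f xdy : Form m M 1) =
      fun x => ∑ _i : Unit, f x 0 • differential (fun x => f x 1) x := by
  funext x
  rw [← pullback_dcoord hf, Fintype.sum_unique]
  rfl

theorem pullback_areaForm (hf : ContMDiff (𝓡 m) (𝓡 2) ∞ f) :
    (pullback f areaForm : Form m M 2) =
      wedge (differential fun x => f x 0) (differential fun x => f x 1) := by
  funext x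
  have h := wedgeLin_comp (E := Euc m) ((dcoord 0).at (f x)) ((dcoord 1).at (f x))
    (mfderiv (𝓡 m) (𝓡 2) f x)
  refine h.trans ?_
  rw [wedge, ← pullback_dcoord hf, ← pullback_dcoord hf]
  rfl

variable [IsManifold (𝓡 m) ∞ M]

theorem isSmooth_pullback_xdy (hf : ContMDiff (𝓡 m) (𝓡 2) ∞ f) :
    IsSmooth (pullback f xdy : Form m M 1) := by
  rw [pullback_xdy hf]
  exact IsSmooth.sum_smul (a := fun _ x => f x 0)
    (fun _ e he => contDiffOn_comp_symm (contMDiff_coord hf 0) he)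
    fun _ => isSmooth_differential (contMDiff_coord hf 1)

/-- Naturality of d for f ∘ e⁻¹ between Euclidean spaces, followed by the chain rule to remove the
chart. -/
theorem extD_pullback_xdy (hf : ContMDiff (𝓡 m) (𝓡 2) ∞ f) :
    extD (pullback f xdy : Form m M 1) = pullback f areaForm := by
  funext x
  set e := chartAt (Euc m) x with he
  have hea : e ∈ atlas (Euc m) M := chart_mem_atlas _ x
  have hx : x ∈ e.source := mem_chart_source _ x
  have hF : ContDiffOn ℝ ∞ (fun y => f (e.symm y)) e.target := contDiffOn_comp_symm hf hea
  have h1 : inChart (pullback f xdy : Form m M 1) e =ᶠ[𝓝 (e x)] fun y =>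
      (xdy.at (f (e.symm y))).compContinuousLinearMap (fderiv ℝ (fun y => f (e.symm y)) y) := by
    filter_upwards [e.open_target.mem_nhds (e.map_source hx)] with y hy
    rw [fderiv_comp_symm hf hea hy]
    rfl
  have h2 : extDeriv (inChart (pullback f xdy : Form m M 1) e) (e x) =
      (areaForm.at (f x)).compContinuousLinearMap (fderiv ℝ (fun y => f (e.symm y)) (e x)) := by
    have h := extDeriv_pullback (f := fun y => f (e.symm y)) (x := e x) (differentiable_xdy _)
      (hF.contDiffAt (e.open_target.mem_nhds (e.map_source hx))) 
        (by rw [minSmoothness_of_isRCLikeNormedField]; exact WithTop.coe_le_coe.2 le_top)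
    rw [h1.extDeriv_eq, h, extDeriv_xdy, e.left_inv hx]
  have h3 := mfderiv_eq_fderiv_comp_symm hf hea hx
  refine (congrArg (fun β : (Euc m) [⋀^Fin 2]→L[ℝ] ℝ =>
    β.compContinuousLinearMap (chartDeriv e x)) h2).trans ?_
  rw [pullback, h3]
  rfl

theorem isSmooth_xdy : IsSmooth xdy := by
  have h := isSmooth_pullback_xdy (contMDiff_id (I := 𝓡 2) (M := Euc 2))
  have h2 : (pullback (id : Euc 2 → Euc 2) xdy : Form 2 (Euc 2) 1) = xdy := by
    funext x
    rw [pullback, mfderiv_id]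
    rfl
  rwa [h2] at h

theorem extD_xdy : extD xdy = areaForm := by
  have h := extD_pullback_xdy (contMDiff_id (I := 𝓡 2) (M := Euc 2))
  have h2 : ∀ {k : ℕ} (θ : Form 2 (Euc 2) k), (pullback (id : Euc 2 → Euc 2) θ : Form 2 _ k) = θ :=
    fun θ => by
      funext x
      rw [pullback, mfderiv_id]
      rfl
  rwa [h2, h2] at h

/-- The pullbacks of `x dy` by maps `f i` such that the pullbacks of the area form span are a
regular tuple. -/
theorem isRegular_pullback_xdy {q : ℕ} {f : Fin q → M → Euc 2}
    (hf : ∀ i, ContMDiff (𝓡 m) (𝓡 2) ∞ (f i))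
    (hspan : ∀ x : M, Submodule.span ℝ
      (Set.range fun i => pullback (m := m) (f i) areaForm x) = ⊤) :
    IsRegular fun i => (pullback (f i) xdy : Form m M 1) := by
  refine ⟨fun i => isSmooth_pullback_xdy (hf i), fun η hη => ?_⟩
  let g : Fin q → Fin 2 → Form m M 1 := fun i t => differential fun x => f i x t
  have hg : ∀ i t, IsSmooth (g i t) := fun i t => isSmooth_differential (contMDiff_coord (hf i) t)
  have hspan3 : ∀ x, Submodule.span ℝ (Set.range fun s : Fin q × Fin q × Fin 2 =>
      wedge (g s.2.1 s.2.2) (wedge (g s.1 0) (g s.1 1)) x) = ⊤ := by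
    intro x
    refine span_wedgeLin_three_eq_top (E := Euc m)
      (fun i t => mfderiv (𝓡 m) 𝓘(ℝ, ℝ) (fun x => f i x t) x) ?_
    have := hspan x
    simp only [pullback_areaForm (hf _)] at this
    exact this
  obtain ⟨a, ha, hη'⟩ := exists_smooth_coefficients
    (fun s : Fin q × Fin q × Fin 2 => (hg s.2.1 s.2.2).wedge ((hg s.1 0).wedge (hg s.1 1))) hη hspan3
  -- Terms are grouped by the index i of the factor df_i^0 ∧ df_i^1 = dθ_i; the other factors add up
  -- to α_i.
  refine ⟨fun i x => ∑ s : Fin q × Fin 2, a (i, s) x • g s.1 s.2 x,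
    fun i => IsSmooth.sum_smul (fun s => ha (i, s)) fun s => hg s.1 s.2, ?_⟩
  funext x
  rw [← hη' x, Fintype.sum_prod_type, Finset.sum_apply]
  refine Finset.sum_congr rfl fun i _ => ?_
  rw [extD_pullback_xdy (hf i), pullback_areaForm (hf i)]
  change wedgeBilin (E := Euc m) (∑ s : Fin q × Fin 2, a (i, s) x • (g s.1 s.2).at x)
    ((wedge (g i 0) (g i 1)).at x) = _
  rw [map_sum, sum_apply]
  refine Finset.sum_congr rfl fun s _ => ?_
  rw [map_smul]
  rfl

end Pullback

/-! ### Hausdorff dimension of sets parametrized as graphs. -/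

section Graph

variable {J : Type*} (R : Set J) [DecidablePred (· ∈ R)]

/-- Extension by zero of a family indexed by the complement of `R`. -/
def extendZero (w : {s // s ∉ R} → ℝ) (s : J) : ℝ := if h : s ∈ R then 0 else w ⟨s, h⟩

theorem extendZero_restrict_of_mem (p : J → ℝ) {s : J} (h : s ∈ R) :
    extendZero R (fun s => p s) s = 0 := dif_pos h

theorem extendZero_restrict_of_notMem (p : J → ℝ) {s : J} (h : s ∉ R) :
    extendZero R (fun s => p s) s = p s := dif_neg h

variable {R} [Fintype J] {Z : Type*} [NormedAddCommGroup Z] [NormedSpace ℝ Z]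
  [FiniteDimensional ℝ Z]

/-- If the coordinates in `R` of the points of `B` are `C¹` functions of the other coordinates and
of a parameter in `Z`, then `B` has Hausdorff dimension at most `dim Z + |Rᶜ|`. -/
theorem dimH_le_of_graph {B : Set (J → ℝ)} {W : Set (Z × ({s // s ∉ R} → ℝ))}
    {φ : Z × ({s // s ∉ R} → ℝ) → J → ℝ}
    (hφ : ∀ w ∈ W, ∀ s ∈ R, ContDiffAt ℝ 1 (fun w => φ w s) w)
    (hB : ∀ p ∈ B, ∃ z, (z, fun s : {s // s ∉ R} => p s) ∈ W ∧
      ∀ s ∈ R, p s = φ (z, fun s => p s) s) :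
    dimH B ≤ (Module.finrank ℝ Z + Fintype.card {s // s ∉ R} : ℕ) := by
  -- B lies in the image of W under Ψ, which is C¹ at the points of W, hence locally Lipschitz and
  -- unable to raise the dimension.
  let Ψ : Z × ({s // s ∉ R} → ℝ) → J → ℝ := fun w s => if h : s ∈ R then φ w s else w.2 ⟨s, h⟩
  have hsub : B ⊆ Ψ '' W := by
    intro p hp
    obtain ⟨z, hz, hp'⟩ := hB p hp
    refine ⟨_, hz, ?_⟩
    funext s
    by_cases h : s ∈ R
    · simp only [Ψ, dif_pos h]; exact (hp' s h).symm
    · simp [Ψ, h]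
  have hΨ : ∀ w ∈ W, ContDiffAt ℝ 1 Ψ w := by
    intro w hw
    refine contDiffAt_pi.2 fun s => ?_
    by_cases h : s ∈ R
    · simp only [Ψ, dif_pos h]; exact hφ w hw s h
    · simp only [Ψ, dif_neg h]
      exact (contDiff_apply ℝ ℝ (⟨s, h⟩ : {s // s ∉ R})).contDiffAt.comp w contDiffAt_snd
  calc dimH B ≤ dimH (Ψ '' W) := dimH_mono hsub
    _ ≤ dimH W := dimH_image_le_of_locally_lipschitzOn fun w hw => by
        obtain ⟨K, t, ht, hK⟩ := (hΨ w hw).exists_lipschitzOnWith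
        exact ⟨K, t, mem_nhdsWithin_of_mem_nhds ht, hK⟩
    _ ≤ dimH (Set.univ : Set (Z × ({s // s ∉ R} → ℝ))) := dimH_mono (Set.subset_univ _)
    _ = _ := by
        rw [Real.dimH_univ_eq_finrank, Module.finrank_prod, Module.finrank_fintype_fun_eq_card]

end Graph

/-! ### Dimension of the set of annihilated families. -/

section Degenerate

variable {m q : ℕ}

theorem pairing_eq_sum (ξ : Fin m → Fin m → ℝ) (w : Fin q × Fin 2 × Fin m → ℝ) (i : Fin q) :
    pairing ξ w i = ∑ c, w (i, 0, c) * ∑ d, ξ c d * w (i, 1, d) := by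
  unfold pairing
  refine Finset.sum_congr rfl fun c _ => ?_
  rw [Finset.mul_sum]
  exact Finset.sum_congr rfl fun d _ => by ring

theorem pairing_smul (t : ℝ) (ξ : Fin m → Fin m → ℝ) (w : Fin q × Fin 2 × Fin m → ℝ) (i : Fin q) :
    pairing (fun c d => t * ξ c d) w i = t * pairing ξ w i := by
  simp only [pairing, Finset.mul_sum, mul_assoc]

/-- The pairing is affine in the entry (i, 0, j). Whether the slope vanishes decides how the i-th
equation is solved. -/
theorem pairing_eq_add {ξ : Fin m → Fin m → ℝ} {w w' : Fin q × Fin 2 × Fin m → ℝ} {i : Fin q}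
    {j : Fin m} (h0 : ∀ c ≠ j, w (i, 0, c) = w' (i, 0, c)) (h1 : ∀ d, w (i, 1, d) = w' (i, 1, d)) :
    pairing ξ w i = pairing ξ w' i +
      (w (i, 0, j) - w' (i, 0, j)) * ∑ d, ξ j d * w' (i, 1, d) := by
  rw [pairing_eq_sum, pairing_eq_sum, ← sub_eq_iff_eq_add', ← Finset.sum_sub_distrib]
  simp only [h1, ← sub_mul]
  exact Finset.sum_eq_single j (fun c _ hc => by rw [h0 c hc, sub_self, zero_mul]) (by simp)

variable {Z : Type*} [NormedAddCommGroup Z] [NormedSpace ℝ Z] [FiniteDimensional ℝ Z]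

/-- The families `p` such that some translate `a z + p`, `z ∈ U`, is annihilated by the bivector
`ξ z` form a set of small dimension. -/
theorem dimH_annihilated_le {U : Set Z} {a : Z → Fin q × Fin 2 × Fin m → ℝ}
    {ξ : Z → Fin m → Fin m → ℝ} {j k : Fin m}
    (ha : ∀ z ∈ U, ∀ s, ContDiffAt ℝ 1 (fun z => a z s) z)
    (hξ : ∀ z ∈ U, ∀ c d, ContDiffAt ℝ 1 (fun z => ξ z c d) z)
    (hjk : ∀ z ∈ U, ξ z j k = 1) :
    dimH {p : Fin q × Fin 2 × Fin m → ℝ | ∃ z ∈ U, ∀ i, pairing (ξ z) (a z + p) i = 0} ≤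
      (Module.finrank ℝ Z + (Fintype.card (Fin q × Fin 2 × Fin m) - q) : ℕ) := by
  classical
  -- T records where the slope vanishes. If it is nonzero (T i = 0), the i-th pairing equation is
  -- solved for p(i, 0, j). If it is zero, that vanishing is itself an equation, solved for p(i, 1,
  -- k) because ξ_jk = 1. Either way each i eliminates one entry.
  let B : (Fin q → Fin 2) → Set (Fin q × Fin 2 × Fin m → ℝ) := fun T =>
    {p | ∃ z ∈ U, (∀ i, pairing (ξ z) (a z + p) i = 0) ∧
      ∀ i, T i = 0 ↔ ∑ d, ξ z j d * (a z + p) (i, 1, d) ≠ 0}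
  have hsub : {p | ∃ z ∈ U, ∀ i, pairing (ξ z) (a z + p) i = 0} ⊆ ⋃ T, B T := by
    rintro p ⟨z, hz, hp⟩
    refine Set.mem_iUnion.2 ⟨fun i => if ∑ d, ξ z j d * (a z + p) (i, 1, d) ≠ 0 then 0 else 1,
      z, hz, hp, fun i => ?_⟩
    by_cases h : ∑ d, ξ z j d * (a z + p) (i, 1, d) = 0
    · simp only [h, ne_eq, not_true_eq_false, if_false, one_ne_zero]
    · simp only [h, ne_eq, not_false_eq_true, if_true]
  refine (dimH_mono hsub).trans ?_
  rw [dimH_iUnion]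
  refine iSup_le fun T => ?_
  let r : Fin q → Fin q × Fin 2 × Fin m := fun i => (i, T i, if T i = 0 then j else k)
  have hr : Function.Injective r := fun i i' h => congrArg Prod.fst h
  have hcard : Fintype.card {s // s ∉ Set.range r} = Fintype.card (Fin q × Fin 2 × Fin m) - q := by
    have h1 : Fintype.card {s // s ∈ Set.range r} = q := by
      rw [Fintype.card_congr (Equiv.ofInjective r hr).symm, Fintype.card_fin]
    rw [Fintype.card_subtype_compl, h1]
  rw [← hcard]
  -- The family a z + p with the eliminated entries of p replaced by 0.
  let v : Z × ({s // s ∉ Set.range r} → ℝ) → Fin q × Fin 2 × Fin m → ℝ := fun w =>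
    a w.1 + extendZero (Set.range r) w.2
  refine dimH_le_of_graph (R := Set.range r)
    (W := {w | w.1 ∈ U ∧ ∀ i, T i = 0 → ∑ d, ξ w.1 j d * v w (i, 1, d) ≠ 0})
    (φ := fun w s => if s.2.1 = 0 then
      -(pairing (ξ w.1) (v w) s.1 / ∑ d, ξ w.1 j d * v w (s.1, 1, d)) else
      -∑ d, ξ w.1 j d * v w (s.1, 1, d)) ?_ ?_
  · rintro w ⟨hw, hw'⟩ s ⟨i, rfl⟩
    have hξ' : ∀ c d, ContDiffAt ℝ 1 (fun w : Z × ({s // s ∉ Set.range r} → ℝ) => ξ w.1 c d) w :=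
      fun c d => (hξ w.1 hw c d).comp w contDiffAt_fst
    have ha' : ∀ s, ContDiffAt ℝ 1 (fun w : Z × ({s // s ∉ Set.range r} → ℝ) => a w.1 s) w :=
      fun s => (ha w.1 hw s).comp w contDiffAt_fst
    have hv : ∀ s, ContDiffAt ℝ 1 (fun w => v w s) w := by
      intro s
      refine (ha' s).add ?_
      by_cases h : s ∈ Set.range r
      · simp only [extendZero, dif_pos h]; exact contDiffAt_const
      · simp only [extendZero, dif_neg h]
        exact (contDiff_apply ℝ ℝ (⟨s, h⟩ : {s // s ∉ Set.range r})).contDiffAt.comp w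
          contDiffAt_snd
    have hden : ContDiffAt ℝ 1 (fun w => ∑ d, ξ w.1 j d * v w (i, 1, d)) w :=
      ContDiffAt.sum fun d _ => (hξ' j d).mul (hv _)
    by_cases h : T i = 0
    · simp only [r, h, if_true]
      refine (ContDiffAt.div ?_ hden (hw' i h)).neg
      exact ContDiffAt.sum fun c _ => ContDiffAt.sum fun d _ =>
        (hξ' c d).mul ((hv _).mul (hv _))
    · simp only [r, h, if_false]
      exact hden.neg
  · rintro p ⟨z, hz, hp, hT⟩
    have hnot : ∀ i t c, (t = T i → c ≠ if T i = 0 then j else k) → (i, t, c) ∉ Set.range r := by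
      rintro i t c h ⟨i', hi'⟩
      simp only [r, Prod.mk.injEq] at hi'
      obtain ⟨rfl, h2, h3⟩ := hi'
      exact h h2.symm h3.symm
    have hv : ∀ s ∉ Set.range r, v (z, fun s => p s) s = (a z + p) s := fun s hs => by
      simp only [v, Pi.add_apply, extendZero_restrict_of_notMem _ p hs]
    have hv' : ∀ i, v (z, fun s => p s) (r i) = a z (r i) := fun i => by
      simp only [v, Pi.add_apply, extendZero_restrict_of_mem _ p (Set.mem_range_self i), add_zero]
    have hrow : ∀ i, T i = 0 → ∀ d, v (z, fun s => p s) (i, 1, d) = (a z + p) (i, 1, d) :=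
      fun i hi d => hv _ (hnot i 1 d fun h => by simp [hi] at h)
    refine ⟨z, ⟨hz, fun i hi => ?_⟩, ?_⟩
    · simp only [hrow i hi]
      exact (hT i).1 hi
    · rintro _ ⟨i, rfl⟩
      by_cases hi : T i = 0
      · have hden := (hT i).1 hi
        have h1 := pairing_eq_add (ξ := ξ z) (w := a z + p) (w' := v (z, fun s => p s)) (i := i)
          (j := j) (fun c hc => (hv _ (hnot i 0 c fun _ => by simpa [hi] using hc)).symm)
          (fun d => (hrow i hi d).symm)
        have h2 := hv' i
        simp only [r, hi, if_true] at h2 ⊢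
        have h3 : (a z + p) (i, 0, j) - a z (i, 0, j) = p (i, 0, j) := by simp
        have h4 : ∑ d, ξ z j d * v (z, fun s => p s) (i, 1, d) =
            ∑ d, ξ z j d * (a z + p) (i, 1, d) := by simp only [hrow i hi]
        rw [hp i, h2, h3, h4] at h1
        refine Eq.trans ?_ (congrArg (fun D => -(pairing (ξ z) (v (z, fun s => p s)) i / D)) h4.symm)
        rw [← neg_div, eq_div_iff hden]
        linarith
      · have hi1 : T i = 1 := by omega
        have h0 : ∑ d, ξ z j d * (a z + p) (i, 1, d) = 0 := by
          by_contra h; exact hi ((hT i).2 h)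
        have h2 := hv' i
        simp only [r, hi1, one_ne_zero, if_false] at h2 ⊢
        have h3 : ∑ d, ξ z j d * (a z + p) (i, 1, d) -
            ∑ d, ξ z j d * v (z, fun s => p s) (i, 1, d) = p (i, 1, k) := by
          rw [← Finset.sum_sub_distrib, Finset.sum_eq_single k]
          · rw [hjk z hz, h2, Pi.add_apply]; ring
          · intro d _ hd
            rw [hv _ (hnot i 1 d fun _ => by simpa [hi1] using hd), sub_self]
          · simp
        rw [← h3, h0, zero_sub]

end Degenerate

/-! ### Generic nondegeneracy: density and openness. -/

section Bivector

variable {m : ℕ}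

/-- The pairs `c < d` of coordinates, which index the coordinates of bivectors. -/
abbrev OrderedPair (m : ℕ) : Type := {s : Fin m × Fin m // s.1 < s.2}

/-- The origin of the bound on q: bivector coordinates plus point coordinates. -/
theorem card_orderedPair (m : ℕ) : Fintype.card (OrderedPair m) + m = m * (m + 1) / 2 := by
  have e : OrderedPair m ≃ Σ d : Fin m, Fin d :=
    { toFun := fun s => ⟨s.1.2, ⟨s.1.1, s.2⟩⟩
      invFun := fun s => ⟨(⟨s.2, s.2.2.trans s.1.2⟩, s.1), s.2.2⟩
      left_inv := fun s => rfl
      right_inv := fun s => rfl }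
  rw [Fintype.card_congr e, Fintype.card_sigma]
  simp only [Fintype.card_fin]
  rw [Fin.sum_univ_eq_sum_range (fun i => i) m, ← Finset.sum_range_succ (fun i => i),
    Finset.sum_range_id]
  simp [mul_comm]

/-- The bivector with coordinates `ζ`. -/
def bivector (ζ : OrderedPair m → ℝ) (c d : Fin m) : ℝ :=
  if h : c < d then ζ ⟨(c, d), h⟩ else if h : d < c then -ζ ⟨(d, c), h⟩ else 0

theorem bivector_eq {ξ : Fin m → Fin m → ℝ} (hξ : ∀ c d, ξ c d = - ξ d c) :
    bivector (fun s => ξ s.1.1 s.1.2) = ξ := by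
  funext c d
  rcases lt_trichotomy c d with h | rfl | h
  · simp [bivector, h]
  · have := hξ c c
    simp only [bivector, lt_irrefl, dif_neg, not_false_eq_true]
    linarith
  · simp [bivector, h, h.not_gt, ← hξ c d]

/-- The coordinates of a bivector with a coordinate normalized to `1`. -/
def extendOne (s₀ : OrderedPair m) (ζ : {s // s ≠ s₀} → ℝ) (s : OrderedPair m) : ℝ :=
  if h : s = s₀ then 1 else ζ ⟨s, h⟩

variable {q : ℕ}

/-- Bad translations form a finite union of sets of dimension at most m + (m(m-1)/2 - 1) + (2mq -
q), which is below 2mq by the bound on q. A set of smaller Hausdorff dimension than the space has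
dense complement. -/
theorem dense_nondegenerate (hq : m * (m + 1) / 2 ≤ q) {U : Set (Euc m)}
    {a : Euc m → Fin q × Fin 2 × Fin m → ℝ}
    (ha : ∀ x ∈ U, ∀ s, ContDiffAt ℝ 1 (fun x => a x s) x) :
    Dense {p : Fin q × Fin 2 × Fin m → ℝ | ∀ x ∈ U, Nondegenerate (a x + p)} := by
  let B : OrderedPair m → Set (Fin q × Fin 2 × Fin m → ℝ) := fun s₀ =>
    {p | ∃ z : Euc m × ({s // s ≠ s₀} → ℝ), z ∈ U ×ˢ Set.univ ∧
      ∀ i, pairing (bivector (extendOne s₀ z.2)) (a z.1 + p) i = 0}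
  have hsub : (⋃ s₀, B s₀)ᶜ ⊆
      {p : Fin q × Fin 2 × Fin m → ℝ | ∀ x ∈ U, Nondegenerate (a x + p)} := by
    intro p hp x hx ξ hξ hξ0
    by_contra! hcon
    apply hp
    obtain ⟨s₀, hs₀⟩ : ∃ s₀ : OrderedPair m, ξ s₀.1.1 s₀.1.2 ≠ 0 := by
      by_contra! h
      apply hξ0
      have h' : (fun s : OrderedPair m => ξ s.1.1 s.1.2) = 0 := funext h
      rw [← bivector_eq hξ, h']
      funext c d
      simp [bivector]
    have hξ1 : ∀ c d, (ξ s₀.1.1 s₀.1.2)⁻¹ * ξ c d = -((ξ s₀.1.1 s₀.1.2)⁻¹ * ξ d c) :=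
      fun c d => by rw [hξ c d, mul_neg]
    -- The annihilating bivector is rescaled so that its coordinate s₀ becomes 1.
    refine Set.mem_iUnion.2 ⟨s₀, (x, fun s => (ξ s₀.1.1 s₀.1.2)⁻¹ * ξ s.1.1.1 s.1.1.2),
      ⟨hx, trivial⟩, fun i => ?_⟩
    have h1 : extendOne s₀ (fun s => (ξ s₀.1.1 s₀.1.2)⁻¹ * ξ s.1.1.1 s.1.1.2) =
        fun s => (ξ s₀.1.1 s₀.1.2)⁻¹ * ξ s.1.1 s.1.2 := by
      funext s
      by_cases h : s = s₀
      · subst h; simp [extendOne, hs₀]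
      · simp [extendOne, h]
    simp only [h1]
    rw [bivector_eq (ξ := fun c d => (ξ s₀.1.1 s₀.1.2)⁻¹ * ξ c d) hξ1, pairing_smul, hcon i,
      mul_zero]
  refine Dense.mono hsub ?_
  by_cases hne : Nonempty (OrderedPair m)
  · have hm : 0 < m := by
      obtain ⟨s⟩ := hne
      exact s.1.1.pos
    have hcardpos : 0 < Fintype.card (OrderedPair m) := Fintype.card_pos
    have hJ : Fintype.card (Fin q × Fin 2 × Fin m) = q * (2 * m) := by simp
    have hcard := card_orderedPair m
    apply dense_compl_of_dimH_lt_finrank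
    rw [Module.finrank_fintype_fun_eq_card, dimH_iUnion]
    have hB : ∀ s₀, dimH (B s₀) ≤ (m + (Fintype.card (OrderedPair m) - 1) +
        (Fintype.card (Fin q × Fin 2 × Fin m) - q) : ℕ) := by
      intro s₀
      have hfr : Module.finrank ℝ (Euc m × ({s // s ≠ s₀} → ℝ)) =
          m + (Fintype.card (OrderedPair m) - 1) := by
        rw [Module.finrank_prod, finrank_euclideanSpace_fin, Module.finrank_fintype_fun_eq_card,
          Fintype.card_subtype_compl, Fintype.card_subtype_eq]
      rw [← hfr]
      refine dimH_annihilated_le (U := U ×ˢ Set.univ) (a := fun z => a z.1)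
        (ξ := fun z => bivector (extendOne s₀ z.2)) (j := s₀.1.1) (k := s₀.1.2) ?_ ?_ ?_
      · rintro z hz s
        exact (ha z.1 hz.1 s).comp z contDiffAt_fst
      · intro z _ c d
        have h : ∀ s, ContDiffAt ℝ 1
            (fun z : Euc m × ({s // s ≠ s₀} → ℝ) => extendOne s₀ z.2 s) z := by
          intro s
          by_cases h : s = s₀
          · simp only [extendOne, dif_pos h]; exact contDiffAt_const
          · simp only [extendOne, dif_neg h]
            exact (contDiff_apply ℝ ℝ (⟨s, h⟩ : {s // s ≠ s₀})).contDiffAt.comp z contDiffAt_snd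
        unfold bivector
        split_ifs
        · exact h _
        · exact (h _).neg
        · exact contDiffAt_const
      · intro z _
        have : (⟨(s₀.1.1, s₀.1.2), s₀.2⟩ : OrderedPair m) = s₀ := rfl
        simp only [bivector, dif_pos s₀.2, this, extendOne]
        rfl
    refine (iSup_le hB).trans_lt ?_
    -- With `hcardpos`, this makes the natural-number subtractions in `hB` genuine.
    have hqJ : q ≤ q * (2 * m) := Nat.le_mul_of_pos_right _ (by omega)
    rw [hJ]
    exact_mod_cast (by omega)
  -- When m ≤ 1 there are no nonzero bivectors, so nothing is bad.
  · have : (⋃ s₀, B s₀) = ∅ := Set.iUnion_eq_empty.2 fun s => (hne ⟨s⟩).elim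
    rw [this, Set.compl_empty]
    exact dense_univ

/-- The nonzero bivectors, up to normalization. -/
def bivectorSphere (m : ℕ) : Set (Fin m → Fin m → ℝ) :=
  Metric.sphere 0 1 ∩ {ξ | ∀ c d, ξ c d = - ξ d c}

theorem isCompact_bivectorSphere : IsCompact (bivectorSphere m) := by
  refine (isCompact_sphere 0 1).inter_right ?_
  simp only [Set.ofPred_forall]
  exact isClosed_iInter fun c => isClosed_iInter fun d =>
    isClosed_eq (by fun_prop) (by fun_prop)

/-- Pairings are homogeneous in ξ, so a compact set of bivectors suffices. -/
theorem not_nondegenerate_iff {w : Fin q × Fin 2 × Fin m → ℝ} :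
    ¬ Nondegenerate w ↔ ∃ ξ ∈ bivectorSphere m, ∀ i, pairing ξ w i = 0 := by
  constructor
  · intro h
    simp only [Nondegenerate, not_forall, not_exists, not_not] at h
    obtain ⟨ξ, hξ, hξ0, h⟩ := h
    refine ⟨fun c d => ‖ξ‖⁻¹ * ξ c d, ⟨?_, fun c d => by simp only [hξ c d, mul_neg]⟩, fun i => by
      rw [pairing_smul, h i, mul_zero]⟩
    have h1 : (fun c d => ‖ξ‖⁻¹ * ξ c d) = ‖ξ‖⁻¹ • ξ := rfl
    rw [h1, mem_sphere_zero_iff_norm, norm_smul, norm_inv, norm_norm,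
      inv_mul_cancel₀ (norm_ne_zero_iff.2 hξ0)]
  · rintro ⟨ξ, ⟨h1, h2⟩, h⟩ hw
    obtain ⟨i, hi⟩ := hw ξ h2 (by rintro rfl; simp at h1)
    exact hi (h i)

/-- The bad parameters are the projection of a closed set along the compact factor K ×
`bivectorSphere m`, and such projections are closed maps. -/
theorem isOpen_forall_nondegenerate {X Y : Type*} [TopologicalSpace X] [TopologicalSpace Y]
    {K : Set Y} (hK : IsCompact K) {D : X → Y → Fin q × Fin 2 × Fin m → ℝ}
    (hD : ∀ s, ContinuousOn (fun p : X × Y => D p.1 p.2 s) (Set.univ ×ˢ K)) :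
    IsOpen {A | ∀ y ∈ K, Nondegenerate (D A y)} := by
  have : CompactSpace K := isCompact_iff_compactSpace.1 hK
  have : CompactSpace (bivectorSphere m) := isCompact_iff_compactSpace.1 isCompact_bivectorSphere
  let S : Set (X × (K × bivectorSphere m)) :=
    {p | ∀ i, pairing p.2.2.1 (D p.1 p.2.1) i = 0}
  have hS : IsClosed S := by
    have hD' : ∀ s, Continuous fun p : X × (K × bivectorSphere m) => D p.1 p.2.1 s := fun s =>
      (hD s).comp_continuous (f := fun p : X × (K × bivectorSphere m) => (p.1, (p.2.1 : Y)))
        (by fun_prop) fun p => ⟨trivial, p.2.1.2⟩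
    have hξ : ∀ c d, Continuous fun p : X × (K × bivectorSphere m) => p.2.2.1 c d :=
      fun c d => (continuous_apply_apply c d).comp
        (continuous_subtype_val.comp (continuous_snd.comp continuous_snd))
    simp only [S, Set.ofPred_forall, pairing]
    refine isClosed_iInter fun i => isClosed_eq ?_ continuous_const
    exact continuous_finsetSum _ fun c _ => continuous_finsetSum _ fun d _ =>
      (hξ c d).mul ((hD' _).mul (hD' _))
  have h := isClosedMap_fst_of_compactSpace (X := X) (Y := K × bivectorSphere m) S hS
  convert h.isOpen_compl using 1
  ext A
  simp only [Set.mem_ofPred_eq, Set.mem_compl_iff, Set.mem_image, not_exists, not_and]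
  constructor
  · rintro hA ⟨A', y, ξ⟩ hp rfl
    exact not_nondegenerate_iff.2 ⟨ξ.1, ξ.2, hp⟩ (hA y.1 y.2)
  · intro hA y hy
    by_contra hn
    obtain ⟨ξ, hξ, h0⟩ := not_nondegenerate_iff.1 hn
    exact hA (A, ⟨y, hy⟩, ⟨ξ, hξ⟩) h0 rfl

/-- Varying only the component n₀ of A translates D A by a constant p, and good p exist arbitrarily
close to 0. -/
theorem dense_forall_nondegenerate {ι : Type*} [DecidableEq ι] (hq : m * (m + 1) / 2 ≤ q)
    {U : Set (Euc m)} (n₀ : ι)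
    {D : (ι → Fin q × Fin 2 × Fin m → ℝ) → Euc m → Fin q × Fin 2 × Fin m → ℝ}
    (hD : ∀ A, ∀ x ∈ U, ∀ s, ContDiffAt ℝ 1 (fun x => D A x s) x)
    (hD' : ∀ A p, ∀ x ∈ U, D (A + Pi.single n₀ p) x = D A x + p) :
    Dense {A | ∀ x ∈ U, Nondegenerate (D A x)} := by
  intro A
  have h1 := dense_nondegenerate hq (hD A) 0
  have hc : Continuous fun p : Fin q × Fin 2 × Fin m → ℝ => A + Pi.single n₀ p :=
    continuous_const.add (continuous_single (A := fun _ => Fin q × Fin 2 × Fin m → ℝ) n₀)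
  have h2 := image_closure_subset_closure_image hc (Set.mem_image_of_mem _ h1)
  rw [Pi.single_zero, add_zero] at h2
  refine closure_mono ?_ h2
  rintro _ ⟨p, hp, rfl⟩ x hx
  rw [hD' A p x hx]
  exact hp x hx

end Bivector

/-! ### Maps to the plane built from cut-off charts. -/

section Family

variable {m q : ℕ} {M : Type*} [TopologicalSpace M] [ChartedSpace (Euc m) M]
  {ι : Type*}

/-- The chart at the center of a bump function, cut off by this bump function. -/
def cutoffChart (fs : SmoothBumpCovering ι (𝓡 m) M) (n : ι) (x : M) : Euc m :=
  fs n x • extChartAt (𝓡 m) (fs.c n) x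

/-- The coordinate functions of a family of maps to the plane that are locally finite combinations
of coordinates in charts, cut off by bump functions. -/
def planeCoord (fs : SmoothBumpCovering ι (𝓡 m) M) (A : ι → Fin q × Fin 2 × Fin m → ℝ)
    (i : Fin q) (t : Fin 2) (x : M) : ℝ :=
  ∑ᶠ n, ∑ c, A n (i, t, c) * cutoffChart fs n x c

/-- The maps to the plane with coordinate functions `planeCoord fs A i`. -/
def planeMap (fs : SmoothBumpCovering ι (𝓡 m) M) (A : ι → Fin q × Fin 2 × Fin m → ℝ)
    (i : Fin q) (x : M) : Euc 2 :=
  WithLp.toLp 2 fun t => planeCoord fs A i t x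

variable (fs : SmoothBumpCovering ι (𝓡 m) M) (A : ι → Fin q × Fin 2 × Fin m → ℝ)

theorem support_cutoffChart_subset (i : Fin q) (t : Fin 2) (n : ι) :
    (Function.support fun x => ∑ c, A n (i, t, c) * cutoffChart fs n x c) ⊆
      Function.support (fs n) := by
  intro x hx h0
  apply hx
  simp [cutoffChart, h0]

/-- The components of the differentials of the functions `planeCoord fs A i t` in the chart `e`,
if only the bump functions in `F` matter. -/
def coordDeriv (e : OpenPartialHomeomorph M (Euc m)) (F : Finset ι)
    (A : ι → Fin q × Fin 2 × Fin m → ℝ) (y : Euc m) (s : Fin q × Fin 2 × Fin m) : ℝ :=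
  ∑ n ∈ F, ∑ d, A n (s.1, s.2.1, d) *
    fderiv ℝ (fun y => cutoffChart fs n (e.symm y) d) y (EuclideanSpace.basisFun (Fin m) ℝ s.2.2)

variable {fs} in
-- Where the cut-off chart n₀ is the identity in its own coordinates, its partial derivatives are
-- Kronecker deltas, so a change of A n₀ translates the derivatives by the same amount.
theorem coordDeriv_add_single [DecidableEq ι] {F : Finset ι} {n₀ : ι} (hn₀ : n₀ ∈ F)
    (p : Fin q × Fin 2 × Fin m → ℝ) {y : Euc m}
    (hy : ∀ᶠ z in 𝓝 y, cutoffChart fs n₀ ((chartAt (Euc m) (fs.c n₀)).symm z) = z) :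
    coordDeriv fs (chartAt (Euc m) (fs.c n₀)) F (A + Pi.single n₀ p) y =
      coordDeriv fs (chartAt (Euc m) (fs.c n₀)) F A y + p := by
  funext s
  have h1 : ∀ d, fderiv ℝ (fun y => cutoffChart fs n₀ ((chartAt (Euc m) (fs.c n₀)).symm y) d) y =
      EuclideanSpace.proj d := by
    intro d
    have : (fun y => cutoffChart fs n₀ ((chartAt (Euc m) (fs.c n₀)).symm y) d) =ᶠ[𝓝 y]
        (EuclideanSpace.proj d : Euc m →L[ℝ] ℝ) := by
      filter_upwards [hy] with z hz
      rw [hz]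
      rfl
    rw [this.fderiv_eq, ContinuousLinearMap.fderiv]
  simp only [coordDeriv, Pi.add_apply, add_mul, Finset.sum_add_distrib]
  congr 1
  rw [Finset.sum_eq_single n₀ _ fun h => (h hn₀).elim]
  · simp only [h1, Pi.single_eq_same]
    rw [Finset.sum_eq_single s.2.2]
    · simp
    · intro d _ hd
      simp [hd]
    · simp
  · intro n _ hn
    simp [Pi.single_eq_of_ne hn]

variable [T2Space M] [IsManifold (𝓡 m) ∞ M]

theorem contMDiff_cutoffChart (n : ι) :
    ContMDiff (𝓡 m) 𝓘(ℝ, Euc m) ∞ (cutoffChart fs n) :=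
  (fs n).contMDiff_smul contMDiffOn_extChartAt

theorem contMDiff_cutoffChart_coord (n : ι) (c : Fin m) :
    ContMDiff (𝓡 m) 𝓘(ℝ, ℝ) ∞ fun x => cutoffChart fs n x c :=
  (EuclideanSpace.proj c : Euc m →L[ℝ] ℝ).contMDiff.comp (contMDiff_cutoffChart fs n)

theorem contMDiff_planeCoord (i : Fin q) (t : Fin 2) :
    ContMDiff (𝓡 m) 𝓘(ℝ, ℝ) ∞ (planeCoord fs A i t) := by
  refine contMDiff_finsum (fun n => ?_)
    (fs.locallyFinite.subset fun n => support_cutoffChart_subset fs A i t n)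
  exact contMDiff_finsetSum fun c _ => contMDiff_const.mul (contMDiff_cutoffChart_coord fs n c)

theorem contMDiff_planeMap (i : Fin q) : ContMDiff (𝓡 m) (𝓡 2) ∞ (planeMap fs A i) :=
  ((EuclideanSpace.equiv (Fin 2) ℝ).symm : (Fin 2 → ℝ) →L[ℝ] Euc 2).contMDiff.comp
    (contMDiff_pi_space.2 fun t => contMDiff_planeCoord fs A i t)

variable {fs}

theorem contDiffOn_coordDeriv {e : OpenPartialHomeomorph M (Euc m)} (he : e ∈ atlas (Euc m) M)
    (F : Finset ι) (s : Fin q × Fin 2 × Fin m) :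
    ContDiffOn ℝ 1 (fun y => coordDeriv fs e F A y s) e.target := by
  refine ContDiffOn.sum fun n _ => ContDiffOn.sum fun d _ => contDiffOn_const.mul ?_
  exact ((contDiffOn_comp_symm (contMDiff_cutoffChart_coord fs n d) he).fderiv_of_isOpen
    e.open_target (WithTop.coe_le_coe.2 le_top)).clm_apply contDiffOn_const

theorem continuousOn_coordDeriv {e : OpenPartialHomeomorph M (Euc m)} (he : e ∈ atlas (Euc m) M)
    (F : Finset ι) (s : Fin q × Fin 2 × Fin m) :
    ContinuousOn (fun p : (ι → Fin q × Fin 2 × Fin m → ℝ) × Euc m =>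
      coordDeriv fs e F p.1 p.2 s) (Set.univ ×ˢ e.target) := by
  refine continuousOn_finsetSum _ fun n _ => continuousOn_finsetSum _ fun d _ =>
    ContinuousOn.mul (Continuous.continuousOn (by fun_prop)) ?_
  have h : ContDiffOn ℝ 1 (fun y => fderiv ℝ (fun y => cutoffChart fs n (e.symm y) d) y
      (EuclideanSpace.basisFun (Fin m) ℝ s.2.2)) e.target :=
    ((contDiffOn_comp_symm (contMDiff_cutoffChart_coord fs n d) he).fderiv_of_isOpen
      e.open_target (WithTop.coe_le_coe.2 le_top)).clm_apply contDiffOn_const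
  exact h.continuousOn.comp continuousOn_snd fun p hp => hp.2

theorem fderiv_planeCoord {e : OpenPartialHomeomorph M (Euc m)} (he : e ∈ atlas (Euc m) M)
    {F : Finset ι} {y : Euc m} (hy : y ∈ e.target)
    (hF : ∀ᶠ z in 𝓝 y, ∀ n, fs n (e.symm z) ≠ 0 → n ∈ F) (s : Fin q × Fin 2 × Fin m) :
    fderiv ℝ (fun y => planeCoord fs A s.1 s.2.1 (e.symm y)) y
      (EuclideanSpace.basisFun (Fin m) ℝ s.2.2) = coordDeriv fs e F A y s := by
  have h1 : (fun y => planeCoord fs A s.1 s.2.1 (e.symm y)) =ᶠ[𝓝 y]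
      fun y => ∑ n ∈ F, ∑ d, A n (s.1, s.2.1, d) * cutoffChart fs n (e.symm y) d := by
    filter_upwards [hF] with z hz
    exact finsum_eq_sum_of_support_subset _ fun n hn =>
      hz n (support_cutoffChart_subset fs A s.1 s.2.1 n hn)
  have h2 : ∀ n d, DifferentiableAt ℝ (fun y => cutoffChart fs n (e.symm y) d) y := fun n d =>
    ((contDiffOn_comp_symm (contMDiff_cutoffChart_coord fs n d) he).contDiffAt
      (e.open_target.mem_nhds hy)).differentiableAt (by simp)
  rw [h1.fderiv_eq, fderiv_fun_sum fun n _ => DifferentiableAt.fun_sum fun d _ =>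
    (h2 n d).const_mul _, sum_apply]
  refine Finset.sum_congr rfl fun n _ => ?_
  rw [fderiv_fun_sum fun d _ => (h2 n d).const_mul _, sum_apply]
  refine Finset.sum_congr rfl fun d _ => ?_
  rw [fderiv_const_mul (h2 n d)]
  rfl

/-- The maps `planeMap fs A i` pull back the area form to a spanning family at `x` if the
components of their differentials in a chart are nondegenerate. -/
theorem span_pullback_areaForm_eq_top {e : OpenPartialHomeomorph M (Euc m)}
    (he : e ∈ atlas (Euc m) M) {x : M} (hx : x ∈ e.source)
    (h : Nondegenerate fun s : Fin q × Fin 2 × Fin m =>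
      fderiv ℝ (fun y => planeCoord fs A s.1 s.2.1 (e.symm y)) (e x)
        (EuclideanSpace.basisFun (Fin m) ℝ s.2.2)) :
    Submodule.span ℝ
      (Set.range fun i => pullback (m := m) (planeMap fs A i) areaForm x) = ⊤ := by
  let u : Fin 2 → Fin q → Euc m →L[ℝ] ℝ := fun t i =>
    fderiv ℝ (fun y => planeCoord fs A i t (e.symm y)) (e x)
  have h1 := Nondegenerate.span_eq_top (EuclideanSpace.basisFun (Fin m) ℝ).toBasis
    (u := u 0) (v := u 1) (by
      convert h using 2 with s
      obtain ⟨i, t, c⟩ := s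
      fin_cases t <;> simp [u])
  have h2 := span_range_compContinuousLinearMap h1 (symmDeriv_comp_chartDeriv he hx)
  have h3 : (fun i => (pullback (planeMap fs A i) areaForm : Form m M 2).at x) = fun i =>
      (wedgeLin (covector (u 0 i)) (covector (u 1 i))).compContinuousLinearMap
        (chartDeriv e x) := by
    funext i
    rw [wedgeLin_comp, pullback_areaForm (contMDiff_planeMap fs A i)]
    have h4 : ∀ t, (differential (planeCoord fs A i t) : Form m M 1).at x =
        (covector (u t i)).compContinuousLinearMap (chartDeriv e x) := fun t => by
      rw [Form.at, differential, mfderiv_eq_fderiv_comp_symm (contMDiff_planeCoord fs A i t) he hx]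
      rfl
    rw [← h4, ← h4]
    rfl
  rw [← h3] at h2
  exact h2

end Family

/-! ### Local genericity and the Baire argument. -/

section Existence

variable {m q : ℕ} {M : Type*} [TopologicalSpace M] [ChartedSpace (Euc m) M]
  [T2Space M] {ι : Type*} [IsManifold (𝓡 m) ∞ M]

/-- Near every point, the maps `planeMap fs A i` are nondegenerate for generic `A`. -/
theorem exists_open_dense_span (hq : m * (m + 1) / 2 ≤ q) (fs : SmoothBumpCovering ι (𝓡 m) M)
    (x : M) :
    ∃ K ∈ 𝓝 x, ∃ G : Set (ι → Fin q × Fin 2 × Fin m → ℝ), IsOpen G ∧ Dense G ∧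
      ∀ A ∈ G, ∀ z ∈ K, Submodule.span ℝ
        (Set.range fun i => pullback (m := m) (planeMap fs A i) areaForm z) = ⊤ := by
  classical
  have : LocallyCompactSpace M := ChartedSpace.locallyCompactSpace (Euc m) M
  obtain ⟨W₀, hW₀, hfin⟩ := fs.locallyFinite x
  set n₀ := fs.ind x trivial with hn₀
  set e := chartAt (Euc m) (fs.c n₀) with he
  have hea : e ∈ atlas (Euc m) M := chart_mem_atlas _ _
  have hxe : x ∈ e.source := fs.mem_chartAt_ind_source x trivial
  have hone : ∀ᶠ z in 𝓝 x, fs n₀ z = 1 := fs.eventuallyEq_one x trivial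
  -- On W only finitely many bump functions are nonzero, and the one with index n₀ is identically 1.
  let W : Set M := interior (W₀ ∩ {z | fs n₀ z = 1} ∩ e.source)
  have hxW : x ∈ W := mem_interior_iff_mem_nhds.2
    (inter_mem (inter_mem hW₀ hone) (e.open_source.mem_nhds hxe))
  obtain ⟨K, hK, hxK, hKW⟩ := exists_compact_subset isOpen_interior hxW
  let F : Finset ι := hfin.toFinset
  have hF : ∀ z ∈ W, ∀ n, fs n z ≠ 0 → n ∈ F := fun z hz n hn =>
    hfin.mem_toFinset.2 ⟨z, hn, (interior_subset hz).1.1⟩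
  have hn₀F : n₀ ∈ F := hF x hxW n₀ (by rw [hone.self_of_nhds]; exact one_ne_zero)
  have hWe : ∀ z ∈ W, z ∈ e.source := fun z hz => (interior_subset hz).2
  have hnhds : ∀ y ∈ e '' W, ∀ᶠ z in 𝓝 y, z ∈ e.target ∧ e.symm z ∈ W := by
    rintro _ ⟨z, hz, rfl⟩
    have h1 := e.open_target.mem_nhds (e.map_source (hWe z hz))
    refine (Filter.eventually_of_mem h1 fun _ h => h).and ?_
    have h2 := e.continuousAt_symm (e.map_source (hWe z hz))
    exact h2.eventually (by rw [e.left_inv (hWe z hz)]; exact isOpen_interior.mem_nhds hz)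
  have htarget : e '' W ⊆ e.target := by
    rintro _ ⟨z, hz, rfl⟩
    exact e.map_source (hWe z hz)
  have hKK : e '' K ⊆ e '' W := Set.image_mono hKW
  refine ⟨K, mem_interior_iff_mem_nhds.1 hxK,
    {A | ∀ y ∈ e '' K, Nondegenerate (coordDeriv fs e F A y)}, ?_, ?_, ?_⟩
  · refine isOpen_forall_nondegenerate
      (hK.image_of_continuousOn (e.continuousOn.mono (hKW.trans hWe))) fun s => ?_
    exact (continuousOn_coordDeriv hea F s).mono (Set.prod_mono subset_rfl (hKK.trans htarget))
  · refine dense_forall_nondegenerate hq n₀ (fun A y hy s => ?_) fun A p y hy => ?_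
    · exact (contDiffOn_coordDeriv A hea F s).contDiffAt
        (e.open_target.mem_nhds (htarget (hKK hy)))
    · refine coordDeriv_add_single A hn₀F p ?_
      filter_upwards [hnhds y (hKK hy)] with z hz
      have h1 : fs n₀ (e.symm z) = 1 := (interior_subset hz.2).1.2
      rw [cutoffChart, h1, one_smul]
      simpa using e.right_inv hz.1
  · intro A hA z hz
    refine span_pullback_areaForm_eq_top A hea (hWe z (hKW hz)) ?_
    have h1 := hA (e z) ⟨z, hz, rfl⟩
    convert h1 using 1
    funext s
    refine fderiv_planeCoord A hea (htarget (hKK ⟨z, hz, rfl⟩)) ?_ s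
    filter_upwards [hnhds (e z) (hKK ⟨z, hz, rfl⟩)] with y hy
    exact hF _ hy.2

theorem exists_span_pullback_areaForm [SecondCountableTopology M] (hq : m * (m + 1) / 2 ≤ q) :
    ∃ f : Fin q → M → Euc 2, (∀ i, ContMDiff (𝓡 m) (𝓡 2) ∞ (f i)) ∧
      ∀ x : M, Submodule.span ℝ
        (Set.range fun i => pullback (m := m) (f i) areaForm x) = ⊤ := by
  have : LocallyCompactSpace M := ChartedSpace.locallyCompactSpace (Euc m) M
  obtain ⟨ι, fs, -⟩ := SmoothBumpCovering.exists_isSubordinate (𝓡 m) (M := M) isClosed_univ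
    (U := fun _ => Set.univ) fun x _ => univ_mem
  -- Countability of ι makes the parameter space a countable product of Polish spaces, to which
  -- Baire's theorem applies.
  have : Countable ι := Set.countable_univ_iff.1
    (fs.locallyFinite.countable_univ fun n => (fs n).nonempty_support)
  choose K hK G hGo hGd hG using exists_open_dense_span (q := q) hq fs
  obtain ⟨S, hS, hcover⟩ := TopologicalSpace.countable_cover_nhds hK
  have : Countable S := hS
  obtain ⟨A, hA⟩ := (dense_iInter_of_isOpen (f := fun x : S => G x) (fun x => hGo x)
    fun x => hGd x).nonempty
  refine ⟨planeMap fs A, contMDiff_planeMap fs A, fun x => ?_⟩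
  obtain ⟨z, hz, hxz⟩ := Set.mem_iUnion₂.1 (hcover ▸ Set.mem_univ x : x ∈ ⋃ z ∈ S, K z)
  exact hG z A (Set.mem_iInter.1 hA ⟨z, hz⟩) x hxz

end Existence

end ManifoldForms

end

open ManifoldForms in
theorem proposition3p2 (m q : ℕ) (hq : m * (m + 1) / 2 ≤ q)
    (M : Type*) [TopologicalSpace M] [T2Space M] [SecondCountableTopology M]
    [ChartedSpace (Euc m) M] [IsManifold (𝓡 m) ∞ M] :
    ∃ θ : Fin q → Form m M 1,
      IsRegular θ ∧
      (∑ i, wedge (θ i) (extD (θ i))) = 0 ∧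
      ∃ (f : Fin q → M → Euc 2) (τ : Form 2 (Euc 2) 1),
        (∀ i, ContMDiff (𝓡 m) (𝓡 2) ∞ (f i)) ∧
        (∀ x : M, Submodule.span ℝ (Set.range fun i => pullback (m := m) (f i) areaForm x) = ⊤) ∧
        IsSmooth τ ∧ extD τ = areaForm ∧
        ∀ i, θ i = pullback (f i) τ := by
  obtain ⟨f, hf, hspan⟩ := exists_span_pullback_areaForm (M := M) hq
  refine ⟨fun i => pullback (f i) xdy, isRegular_pullback_xdy hf hspan, ?_, f, xdy, hf, hspan,
    isSmooth_xdy, extD_xdy, fun i => rfl⟩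
  refine Finset.sum_eq_zero fun i _ => ?_
  rw [extD_pullback_xdy (hf i), wedge_pullback_xdy]
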